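/- For a prime $p$, an integer $H\ge 1$, a multiplicative subgroup $\mathcal G\subseteq\mathbb F_p^*$ of order $T$, an element $a\in\mathbb F_p^*$ and a multiplicative character $\chi$ of $\mathbb F_p$ (extended by $\chi(0)=0$), put $$S_\chi(a,\mathcal I,\mathcal G)=\sum_{x\in\mathcal I}\ \sum_{\lambda\in\mathcal G}\chi(x+a\lambda),\qquad \mathcal I=\{1,\dots,H\}.$$ Theorem. Let $H=p^{1/4+o(1)}$ and $T=p^{1/2+o(1)}$ as $p\to\infty$. Then, for the interval $\mathcal I=\{1,\dots,H\}$ and the multiplicative subgroup $\mathcal G\subseteq\mathbb F_p^*$ of order $T$, $$|S_\chi(a,\mathcal I,\mathcal G)|\le HT\,p^{-5/48+o(1)}$$ uniformly over $a\in\mathbb F_p^*$ and nonprincipal multiplicative characters $\chi$ of $\mathbb F_p$. Explicitly: for any functions $\alpha(p)\to0$ and $\beta(p)\to0$ there is a function $\rho(p)\to0$ (as $p\to\infty$), depending only on $\alpha$ and $\beta$, such that for every prime $p$, all integers $H,T$ with $p^{1/4-\alpha(p)}\le H\le p^{1/4+\alpha(p)}$ and $p^{1/2-\beta(p)}\le T\le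 p^{1/2+\beta(p)}$, every subgroup $\mathcal G\subseteq\mathbb F_p^*$ of order $T$, every $a\in\mathbb F_p^*$ and every nonprincipal $\chi$, one has $|S_\chi(a,\mathcal I,\mathcal G)|\le HT\,p^{-5/48+\rho(p)}$. -/

import Mathlib

open Filter Topology

open Classical in
/-- The sum `∑_{x ∈ {1, …, H}} ∑_{l ∈ G} χ (x + a l)` over an interval and a multiplicative
subgroup `G` of `𝔽_p^*`. The character `χ` is extended to `𝔽_p` by `χ 0 = 0`. -/
noncomputable def intervalSubgroupSum {p : ℕ} [Fact p.Prime] (χ : MulChar (ZMod p) ℂ)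
    (a : (ZMod p)ˣ) (H : ℕ) (G : Subgroup (ZMod p)ˣ) : ℂ :=
  ∑ x ∈ Finset.Icc 1 H, ∑ l : G, χ ((x : ZMod p) + (a : ZMod p) * ((l : (ZMod p)ˣ) : ZMod p))

/-! ### Divisor bounds -/

/-! The modulus of the sum of `χ (x + a l)` over `l` in `G` does not change when `x` is multiplied
by an element of `G`. Averaging over these dilations and applying Cauchy–Schwarz, with complete
orthogonality for the second moment over all shifts, gives `|S|² ≤ 2pJ`, where `J` counts pairs `x,
y ≤ H` with `x / y` in `G` (`norm_intervalSubgroupSum_sq_le`). It remains to show `J ≤ H p^(1/24 +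
o(1))`.

Removing gcds reduces this to coprime pairs of height `h ≤ H`; let `N` be their number. Products of
`k` such fractions again have ratio in `G` and height at most `h^k`. The divisor bound controls
repetitions, after thinning the set so that the products stay reduced. For each `g` in `G`, spacing
of fractions leaves `O(h^(2k)/p + 1)` reduced fractions congruent to `g`, so `N^k ≤ p^o(1) T
(h^(2k)/p + 1)` (`card_coprimeRatioPairs_pow_le`). With `h = p^θ` and `T ≈ p^(1/2)`, this gives `N ≤
h p^(1/24 + o(1))` when `|θ - 1/(2k)| ≤ 1/24`. The values `k = 2, 3, 4, 6` and the trivial bound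
`h²` cover all `θ` up to `1/4`. The critical point is `θ = 5/24`, where `k = 2` and `k = 3` meet; it
fixes the exponent `1/24`, hence `5/48`. -/

theorem two_pow_card_primeFactors_le_card_divisors {n : ℕ} (hn : n ≠ 0) :
    2 ^ n.primeFactors.card ≤ n.divisors.card := by
  rw [Nat.card_divisors hn, ← Finset.prod_const]
  refine Finset.prod_le_prod' fun q hq => ?_
  have := (Nat.prime_of_mem_primeFactors hq).factorization_pos_of_dvd hn
    (Nat.dvd_of_mem_primeFactors hq)
  omega

/-- Each prime `q ≥ 2^(1/ε)` satisfies `e + 1 ≤ 2^e ≤ q^(εe)` at no cost; the boundedly many smaller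
primes cost a factor `K` each. -/
theorem exists_card_divisors_le_rpow {ε : ℝ} (hε : 0 < ε) :
    ∃ C : ℝ, 1 ≤ C ∧ ∀ n : ℕ, n ≠ 0 → (n.divisors.card : ℝ) ≤ C * (n : ℝ) ^ ε := by
  have hl : 0 < Real.log 2 := Real.log_pos (by norm_num)
  set K : ℝ := 1 + 1 / (ε * Real.log 2) with hK
  have hK1 : 1 ≤ K := by rw [hK]; linarith [show 0 < 1 / (ε * Real.log 2) by positivity]
  set P : ℕ := ⌈(2 : ℝ) ^ (1 / ε)⌉₊ with hP
  refine ⟨K ^ P, one_le_pow₀ hK1, fun n hn => ?_⟩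
  have hfac : ∀ q ∈ n.primeFactors, ((n.factorization q + 1 : ℕ) : ℝ) ≤
      (if q < P then K else 1) * ((q : ℝ) ^ n.factorization q) ^ ε := by
    intro q hq
    have hq2 : (2 : ℝ) ≤ q := by exact_mod_cast (Nat.prime_of_mem_primeFactors hq).two_le
    set e := n.factorization q
    have hcomm : ((q : ℝ) ^ e) ^ ε = ((q : ℝ) ^ ε) ^ e := by
      rw [← Real.rpow_natCast, ← Real.rpow_mul (by linarith), mul_comm, Real.rpow_mul (by linarith),
        Real.rpow_natCast]
    split_ifs with h
    · have h1 : (2 : ℝ) ^ ε ≤ (q : ℝ) ^ ε := Real.rpow_le_rpow (by norm_num) hq2 hε.le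
      have h2 : 1 + ε * Real.log 2 ≤ (2 : ℝ) ^ ε := by
        rw [Real.rpow_def_of_pos (by norm_num)]
        linarith [Real.add_one_le_exp (Real.log 2 * ε)]
      have h3 : 1 + (e : ℝ) * (ε * Real.log 2) ≤ ((q : ℝ) ^ ε) ^ e :=
        (one_add_mul_le_pow (by linarith [mul_pos hε hl]) e).trans
          (pow_le_pow_left₀ (by positivity) (h2.trans h1) e)
      rw [hcomm]
      refine le_trans ?_ (mul_le_mul_of_nonneg_left h3 (by linarith))
      have : K * (1 + (e : ℝ) * (ε * Real.log 2)) =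
          1 + e + e * (ε * Real.log 2) + 1 / (ε * Real.log 2) := by
        rw [hK]; field_simp; ring
      rw [this]; push_cast
      have : 0 ≤ (e : ℝ) * (ε * Real.log 2) + 1 / (ε * Real.log 2) := by positivity
      linarith
    · have h1 : (2 : ℝ) ≤ (q : ℝ) ^ ε := by
        have hq' : (2 : ℝ) ^ (1 / ε) ≤ q := (Nat.le_ceil _).trans (by exact_mod_cast not_lt.mp h)
        have := Real.rpow_le_rpow (by positivity) hq' hε.le
        rwa [← Real.rpow_mul (by norm_num), one_div_mul_cancel hε.ne', Real.rpow_one] at this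
      rw [hcomm, one_mul]
      refine le_trans ?_ (pow_le_pow_left₀ (by norm_num) h1 e)
      exact_mod_cast Nat.lt_two_pow_self
  rw [Nat.card_divisors hn, Nat.cast_prod]
  refine (Finset.prod_le_prod (fun _ _ => by positivity) hfac).trans ?_
  rw [Finset.prod_mul_distrib, Real.finsetProd_rpow _ _ (fun _ _ => by positivity)]
  have hn' : ∏ q ∈ n.primeFactors, (q : ℝ) ^ n.factorization q = n := by
    have := Nat.prod_factorization_pow_eq_self hn
    rw [Finsupp.prod, Nat.support_factorization] at this
    exact_mod_cast this
  rw [hn']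
  refine mul_le_mul_of_nonneg_right ?_ (by positivity)
  rw [Finset.prod_ite, Finset.prod_const_one, mul_one, Finset.prod_const]
  refine pow_le_pow_right₀ hK1 ?_
  refine (Finset.card_le_card (t := Finset.range P) fun q hq => ?_).trans (by simp)
  simpa using (Finset.mem_filter.mp hq).2

/-! ### Splitting the primes between numerators and denominators -/

/-- A set of reduced fractions has a large subset in which every numerator is coprime to every
denominator. -/
theorem exists_subset_forall_coprime (A : Finset (ℕ × ℕ)) (D : ℕ)
    (hpos : ∀ a ∈ A, a.1 ≠ 0 ∧ a.2 ≠ 0) (hcop : ∀ a ∈ A, a.1.Coprime a.2)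
    (hD : ∀ a ∈ A, a.1.divisors.card ≤ D ∧ a.2.divisors.card ≤ D) :
    ∃ A' ⊆ A, A.card ≤ D ^ 2 * A'.card ∧ ∀ a ∈ A', ∀ b ∈ A', a.1.Coprime b.2 := by
  classical
  set P : Finset ℕ := A.biUnion fun a => a.1.primeFactors ∪ a.2.primeFactors with hP
  let B : Finset ℕ → Finset (ℕ × ℕ) := fun S =>
    A.filter fun a => a.1.primeFactors ⊆ S ∧ Disjoint a.2.primeFactors S
  -- A random set `S` of primes contains the primes of the numerator and avoids those of the
  -- denominator with probability at least `1 / D²`; averaging then yields one good `S`.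
  have hcount : ∀ a ∈ A, 2 ^ P.card ≤ D ^ 2 *
      (P.powerset.filter fun S => a.1.primeFactors ⊆ S ∧ Disjoint a.2.primeFactors S).card := by
    intro a ha
    set X := a.1.primeFactors
    set Y := a.2.primeFactors
    have hXY : Disjoint X Y := (hcop a ha).disjoint_primeFactors
    have hsub : X ∪ Y ⊆ P := Finset.subset_biUnion_of_mem
      (fun a : ℕ × ℕ => a.1.primeFactors ∪ a.2.primeFactors) ha
    have h1 : 2 ^ (P \ (X ∪ Y)).card ≤
        (P.powerset.filter fun S => X ⊆ S ∧ Disjoint Y S).card := by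
      rw [← Finset.card_powerset]
      refine Finset.card_le_card_of_injOn (fun S => X ∪ S) ?_ ?_
      · intro S hS
        have hS' : S ⊆ P \ (X ∪ Y) := Finset.mem_powerset.mp hS
        have hSP : S ⊆ P := hS'.trans Finset.sdiff_subset
        have hdis : Disjoint S (X ∪ Y) := Finset.disjoint_of_subset_left hS' Finset.sdiff_disjoint
        simp only [Finset.coe_filter, Finset.mem_powerset, Set.mem_ofPred_eq]
        refine ⟨Finset.union_subset (Finset.subset_union_left.trans hsub) hSP,
          Finset.subset_union_left, ?_⟩
        rw [Finset.disjoint_union_right] at hdis ⊢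
        exact ⟨hXY.symm, hdis.2.symm⟩
      · intro S hS S' hS' h
        have key : ∀ S ∈ (P \ (X ∪ Y)).powerset, (X ∪ S) \ X = S := by
          intro S hS
          have hS' : S ⊆ P \ (X ∪ Y) := by simpa using hS
          have hdis : Disjoint S (X ∪ Y) :=
            Finset.disjoint_of_subset_left hS' Finset.sdiff_disjoint
          rw [Finset.disjoint_union_right] at hdis
          exact Finset.union_sdiff_cancel_left hdis.1.symm
        rw [← key S hS, ← key S' hS']
        exact congrArg (· \ X) h
    have h2 : 2 ^ (X ∪ Y).card ≤ D ^ 2 := by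
      rw [Finset.card_union_of_disjoint hXY, pow_add, sq]
      exact Nat.mul_le_mul
        ((two_pow_card_primeFactors_le_card_divisors (hpos a ha).1).trans (hD a ha).1)
        ((two_pow_card_primeFactors_le_card_divisors (hpos a ha).2).trans (hD a ha).2)
    have h3 : P.card = (X ∪ Y).card + (P \ (X ∪ Y)).card := by
      rw [Finset.card_sdiff_of_subset hsub]
      have := Finset.card_le_card hsub
      omega
    rw [h3, pow_add]
    exact Nat.mul_le_mul h2 h1
  have hex : ∃ S ∈ P.powerset, A.card ≤ D ^ 2 * (B S).card := by
    by_contra! hcon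
    have h1 : ∑ S ∈ P.powerset, D ^ 2 * (B S).card < ∑ S ∈ P.powerset, A.card :=
      Finset.sum_lt_sum_of_nonempty ⟨∅, by simp⟩ hcon
    have h2 : ∑ S ∈ P.powerset, (B S).card = ∑ a ∈ A,
        (P.powerset.filter fun S => a.1.primeFactors ⊆ S ∧ Disjoint a.2.primeFactors S).card := by
      simp only [B, Finset.card_filter]
      exact Finset.sum_comm
    rw [← Finset.mul_sum, h2, Finset.sum_const, Finset.card_powerset, smul_eq_mul,
      Finset.mul_sum] at h1
    have h3 := Finset.sum_le_sum hcount
    rw [Finset.sum_const, smul_eq_mul, mul_comm] at h3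
    exact absurd (h3.trans_lt h1) (lt_irrefl _)
  obtain ⟨S, -, hS⟩ := hex
  refine ⟨B S, Finset.filter_subset _ _, hS, fun a ha b hb => ?_⟩
  have ha' := Finset.mem_filter.mp ha
  have hb' := Finset.mem_filter.mp hb
  rw [← Nat.disjoint_primeFactors (hpos a ha'.1).1 (hpos b hb'.1).2]
  exact Finset.disjoint_of_subset_left ha'.2.1 hb'.2.2.symm

/-! ### Primitive points on a line modulo `p` -/

/-- Two fractions in `[0, 1]` congruent to the same `g` have cross-difference divisible by `p`, so
distinct ones are at least `p / M²` apart. Hence each interval of length `p / M²` holds at most one.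
-/
theorem card_coprime_ordered_le {p : ℕ} (hp : 0 < p) (g : ZMod p) (M : ℕ) (L : Finset (ℕ × ℕ))
    (hL : ∀ a ∈ L, 0 < a.2 ∧ a.1 ≤ a.2 ∧ a.2 ≤ M ∧ a.1.Coprime a.2 ∧ (a.1 : ZMod p) = g * a.2) :
    L.card ≤ M ^ 2 / p + 1 := by
  rw [← Finset.card_range (M ^ 2 / p + 1)]
  refine Finset.card_le_card_of_injOn (fun a => a.1 * M ^ 2 / (a.2 * p)) ?_ ?_
  · intro a ha
    obtain ⟨h0, h1, -⟩ := hL a ha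
    simp only [Finset.coe_range, Set.mem_Iio, Nat.lt_succ_iff]
    rw [← Nat.mul_div_mul_left (M ^ 2) p h0]
    exact Nat.div_le_div_right (Nat.mul_le_mul_right _ h1)
  · have key : ∀ a ∈ L, ∀ b ∈ L, a.1 * M ^ 2 / (a.2 * p) = b.1 * M ^ 2 / (b.2 * p) →
        a.1 * b.2 < b.1 * a.2 + p := by
      intro a ha b hb h
      obtain ⟨a0, a1, a2, -, -⟩ := hL a ha
      obtain ⟨b0, b1, b2, -, -⟩ := hL b hb
      set q := a.1 * M ^ 2 / (a.2 * p)
      have e1 : a.1 * M ^ 2 < (a.2 * p) * (q + 1) :=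
        Nat.lt_mul_div_succ _ (Nat.mul_pos a0 hp)
      have e2 : (b.2 * p) * q ≤ b.1 * M ^ 2 := by
        rw [h]; exact Nat.mul_div_le _ _
      have hM : 0 < M ^ 2 := pow_pos (by omega) 2
      have h3 : a.2 * b.2 ≤ M ^ 2 := by rw [sq]; exact Nat.mul_le_mul a2 b2
      refine lt_of_mul_lt_mul_right (a := M ^ 2) ?_ hM.le
      calc a.1 * b.2 * M ^ 2 = (a.1 * M ^ 2) * b.2 := by ring
        _ < ((a.2 * p) * (q + 1)) * b.2 := Nat.mul_lt_mul_of_pos_right e1 b0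
        _ = ((b.2 * p) * q) * a.2 + (a.2 * b.2) * p := by ring
        _ ≤ (b.1 * M ^ 2) * a.2 + M ^ 2 * p :=
          add_le_add (Nat.mul_le_mul_right _ e2) (Nat.mul_le_mul_right _ h3)
        _ = (b.1 * a.2 + p) * M ^ 2 := by ring
    intro a ha b hb h
    have k1 := key a ha b hb h
    have k2 := key b hb a ha h.symm
    obtain ⟨a0, -, -, a3, a4⟩ := hL a ha
    obtain ⟨b0, -, -, b3, b4⟩ := hL b hb
    have hmod : ((a.1 * b.2 : ℕ) : ZMod p) = ((b.1 * a.2 : ℕ) : ZMod p) := by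
      push_cast; rw [a4, b4]; ring
    rw [ZMod.natCast_eq_natCast_iff] at hmod
    have heq : a.1 * b.2 = b.1 * a.2 := by
      rcases le_total (a.1 * b.2) (b.1 * a.2) with hle | hle
      · have := (Nat.modEq_iff_dvd' hle).mp hmod
        have := Nat.eq_zero_of_dvd_of_lt this (by omega)
        omega
      · have := (Nat.modEq_iff_dvd' hle).mp hmod.symm
        have := Nat.eq_zero_of_dvd_of_lt this (by omega)
        omega
    have d1 : a.2 ∣ b.2 := a3.symm.dvd_of_dvd_mul_left (Dvd.intro_left _ heq.symm)
    have d2 : b.2 ∣ a.2 := b3.symm.dvd_of_dvd_mul_left (Dvd.intro_left _ heq)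
    have e : a.2 = b.2 := Nat.dvd_antisymm d1 d2
    rw [e] at heq
    exact Prod.ext (Nat.eq_of_mul_eq_mul_right b0 heq) e

/-- Swapping coordinates replaces `g` by `g⁻¹`, which handles the fractions above `1`. -/
theorem card_coprime_le {p : ℕ} (hp : 0 < p) (g : (ZMod p)ˣ) (M : ℕ) (L : Finset (ℕ × ℕ))
    (hL : ∀ a ∈ L, 0 < a.1 ∧ 0 < a.2 ∧ a.1 ≤ M ∧ a.2 ≤ M ∧ a.1.Coprime a.2 ∧
      (a.1 : ZMod p) = g * a.2) :
    L.card ≤ 2 * (M ^ 2 / p + 1) := by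
  classical
  rw [← Finset.card_filter_add_card_filter_not (s := L) (fun a => a.1 ≤ a.2), two_mul]
  refine add_le_add (card_coprime_ordered_le hp g M _ fun a ha => ?_) ?_
  · obtain ⟨ha, hle⟩ := Finset.mem_filter.mp ha
    obtain ⟨h1, h2, h3, h4, h5, h6⟩ := hL a ha
    exact ⟨h2, hle, h4, h5, h6⟩
  · rw [← Finset.card_image_of_injective _ Prod.swap_injective]
    refine card_coprime_ordered_le hp (g⁻¹ : (ZMod p)ˣ) M _ fun a ha => ?_
    obtain ⟨b, hb, rfl⟩ := Finset.mem_image.mp ha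
    obtain ⟨hb, hle⟩ := Finset.mem_filter.mp hb
    obtain ⟨h1, h2, h3, h4, h5, h6⟩ := hL b hb
    refine ⟨h1, (not_le.mp hle).le, h3, h5.symm, ?_⟩
    simp [h6]

/-! ### Pairs of small integers with ratio in a subgroup -/

open Classical in
/-- The pairs `(x, y)` with `1 ≤ x, y ≤ H` whose ratio modulo `p` lies in `G`. -/
noncomputable def ratioPairs {p : ℕ} (G : Subgroup (ZMod p)ˣ) (H : ℕ) : Finset (ℕ × ℕ) :=
  (Finset.Icc 1 H ×ˢ Finset.Icc 1 H).filter fun a => ∃ g ∈ G, (a.1 : ZMod p) = g * a.2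

open Classical in
/-- The coprime pairs among `ratioPairs G H`. -/
noncomputable def coprimeRatioPairs {p : ℕ} (G : Subgroup (ZMod p)ˣ) (H : ℕ) : Finset (ℕ × ℕ) :=
  (ratioPairs G H).filter fun a => a.1.Coprime a.2

theorem mem_ratioPairs {p : ℕ} {G : Subgroup (ZMod p)ˣ} {H : ℕ} {a : ℕ × ℕ} :
    a ∈ ratioPairs G H ↔ ((0 < a.1 ∧ a.1 ≤ H) ∧ (0 < a.2 ∧ a.2 ≤ H)) ∧
      ∃ g ∈ G, (a.1 : ZMod p) = g * a.2 := by
  simp [ratioPairs, Nat.succ_le_iff]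

theorem mem_coprimeRatioPairs {p : ℕ} {G : Subgroup (ZMod p)ˣ} {H : ℕ} {a : ℕ × ℕ} :
    a ∈ coprimeRatioPairs G H ↔ a ∈ ratioPairs G H ∧ a.1.Coprime a.2 := by
  simp [coprimeRatioPairs]

theorem card_coprimeRatioPairs_le_sq {p : ℕ} (G : Subgroup (ZMod p)ˣ) (H : ℕ) :
    (coprimeRatioPairs G H).card ≤ H ^ 2 := by
  classical
  refine (Finset.card_filter_le _ _).trans ((Finset.card_filter_le _ _).trans ?_)
  simp [sq]

/-- Pairs are sorted by their gcd `d`, which is invertible modulo `p` because `d ≤ H < p`. -/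
theorem card_ratioPairs_le_sum {p : ℕ} [Fact p.Prime] (G : Subgroup (ZMod p)ˣ) {H : ℕ}
    (hH : H < p) :
    (ratioPairs G H).card ≤ ∑ d ∈ Finset.Icc 1 H, (coprimeRatioPairs G (H / d)).card := by
  rw [← Finset.card_sigma]
  refine Finset.card_le_card_of_injOn
    (fun a => (⟨a.1.gcd a.2, (a.1 / a.1.gcd a.2, a.2 / a.1.gcd a.2)⟩ : Σ _ : ℕ, ℕ × ℕ)) ?_ ?_
  · intro a ha
    obtain ⟨⟨⟨h1, h2⟩, h3, h4⟩, g, hg, h5⟩ := mem_ratioPairs.mp ha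
    set d := a.1.gcd a.2
    have hd : 0 < d := Nat.gcd_pos_of_pos_left _ h1
    have hd1 : d ∣ a.1 := Nat.gcd_dvd_left _ _
    have hd2 : d ∣ a.2 := Nat.gcd_dvd_right _ _
    have hdH : d ≤ H := (Nat.le_of_dvd h1 hd1).trans h2
    simp only [Finset.coe_sigma, Set.mem_sigma_iff, Finset.mem_coe, Finset.mem_Icc]
    refine ⟨⟨hd, hdH⟩, mem_coprimeRatioPairs.mpr ⟨mem_ratioPairs.mpr ⟨⟨⟨?_, ?_⟩, ?_, ?_⟩, g, hg, ?_⟩,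
      Nat.coprime_div_gcd_div_gcd hd⟩⟩
    · exact Nat.div_pos (Nat.le_of_dvd h1 hd1) hd
    · exact Nat.div_le_div_right h2
    · exact Nat.div_pos (Nat.le_of_dvd h3 hd2) hd
    · exact Nat.div_le_div_right h4
    · have hdp : (d : ZMod p) ≠ 0 := by
        rw [Ne, ZMod.natCast_eq_zero_iff]
        exact fun h => absurd (Nat.le_of_dvd hd h) (by omega)
      refine mul_left_cancel₀ hdp ?_
      have e1 : (d : ZMod p) * ((a.1 / d : ℕ) : ZMod p) = a.1 := by
        rw [← Nat.cast_mul, Nat.mul_div_cancel' hd1]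
      have e2 : (d : ZMod p) * ((a.2 / d : ℕ) : ZMod p) = a.2 := by
        rw [← Nat.cast_mul, Nat.mul_div_cancel' hd2]
      rw [mul_left_comm, e1, e2, h5]
  · intro a ha b hb h
    simp only [Sigma.mk.injEq, heq_eq_eq, Prod.mk.injEq] at h
    obtain ⟨h0, h1, h2⟩ := h
    rw [h0] at h1 h2
    refine Prod.ext ?_ ?_
    · exact (Nat.div_left_inj (h0 ▸ Nat.gcd_dvd_left _ _) (Nat.gcd_dvd_left _ _)).mp h1
    · exact (Nat.div_left_inj (h0 ▸ Nat.gcd_dvd_right _ _) (Nat.gcd_dvd_right _ _)).mp h2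

theorem card_pow_le_of_forall_coprime {p : ℕ} [Fact p.Prime] (G : Subgroup (ZMod p)ˣ) {h k D : ℕ}
    (hD : ∀ n, 0 < n → n ≤ h ^ k → n.divisors.card ≤ D) (A : Finset (ℕ × ℕ))
    (hA : A ⊆ ratioPairs G h) (hcop : ∀ a ∈ A, ∀ b ∈ A, a.1.Coprime b.2) :
    A.card ^ k ≤ D ^ (2 * k) * (Nat.card G * (2 * ((h ^ k) ^ 2 / p + 1))) := by
  classical
  have hp : 0 < p := (Fact.out : p.Prime).pos
  have hmem := fun a (ha : a ∈ A) => mem_ratioPairs.mp (hA ha)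
  set U := Fintype.piFinset fun _ : Fin k => A with hU
  have hUc : U.card = A.card ^ k := by simp [hU]
  let φ : (Fin k → ℕ × ℕ) → ℕ × ℕ := fun t => (∏ i, (t i).1, ∏ i, (t i).2)
  have hφ : ∀ t ∈ U, (0 < (φ t).1 ∧ (φ t).1 ≤ h ^ k) ∧ (0 < (φ t).2 ∧ (φ t).2 ≤ h ^ k) ∧
      (φ t).1.Coprime (φ t).2 ∧ ∃ g ∈ G, ((φ t).1 : ZMod p) = g * (φ t).2 := by
    intro t ht
    have ht' : ∀ i, t i ∈ A := Fintype.mem_piFinset.mp ht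
    change (0 < ∏ i, (t i).1 ∧ ∏ i, (t i).1 ≤ h ^ k) ∧ (0 < ∏ i, (t i).2 ∧ ∏ i, (t i).2 ≤ h ^ k) ∧
      (∏ i, (t i).1).Coprime (∏ i, (t i).2) ∧ _
    refine ⟨⟨Finset.prod_pos fun i _ => (hmem _ (ht' i)).1.1.1, ?_⟩,
      ⟨Finset.prod_pos fun i _ => (hmem _ (ht' i)).1.2.1, ?_⟩, ?_, ?_⟩
    · refine (Finset.prod_le_pow_card _ _ h fun i _ => (hmem _ (ht' i)).1.1.2).trans (by simp)
    · refine (Finset.prod_le_pow_card _ _ h fun i _ => (hmem _ (ht' i)).1.2.2).trans (by simp)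
    · exact Nat.Coprime.prod_left fun i _ => Nat.Coprime.prod_right fun j _ =>
        hcop _ (ht' i) _ (ht' j)
    · choose g hg hg' using fun i => (hmem _ (ht' i)).2
      refine ⟨∏ i, g i, Subgroup.prod_mem _ fun i _ => hg i, ?_⟩
      simp only [φ, Nat.cast_prod, Units.coe_prod, ← Finset.prod_mul_distrib]
      exact Finset.prod_congr rfl fun i _ => hg' i
  rw [← hUc]
  -- Every factor of a given product divides it, so a fibre has at most `(D²)^k` elements; the image
  -- is then split according to its ratio `g`.
  refine (Finset.card_le_mul_card_image (f := φ) U (D ^ (2 * k)) ?_).trans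
    (Nat.mul_le_mul_left _ ?_)
  · intro c hc
    obtain ⟨t₀, ht₀, rfl⟩ := Finset.mem_image.mp hc
    obtain ⟨⟨h1, h2⟩, ⟨h3, h4⟩, -⟩ := hφ t₀ ht₀
    refine (Finset.card_le_card (t := Fintype.piFinset fun _ : Fin k =>
      (φ t₀).1.divisors ×ˢ (φ t₀).2.divisors) ?_).trans ?_
    · intro t ht
      obtain ⟨-, ht⟩ := Finset.mem_filter.mp ht
      rw [Fintype.mem_piFinset]
      intro i
      rw [← ht, Finset.mem_product, Nat.mem_divisors, Nat.mem_divisors]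
      exact ⟨⟨Finset.dvd_prod_of_mem (fun i => (t i).1) (Finset.mem_univ i), by rw [ht]; omega⟩,
        ⟨Finset.dvd_prod_of_mem (fun i => (t i).2) (Finset.mem_univ i), by rw [ht]; omega⟩⟩
    · rw [Fintype.card_piFinset_const, Finset.card_product, pow_mul, sq]
      exact Nat.pow_le_pow_left (Nat.mul_le_mul (hD _ h1 h2) (hD _ h3 h4)) k
  · refine (Finset.card_le_card (t := (Finset.univ : Finset G).biUnion fun g =>
      (U.image φ).filter fun c => (c.1 : ZMod p) = ((g : (ZMod p)ˣ) : ZMod p) * c.2) ?_).trans ?_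
    · intro c hc
      obtain ⟨t, ht, rfl⟩ := Finset.mem_image.mp hc
      obtain ⟨-, -, -, g, hg, hg'⟩ := hφ t ht
      exact Finset.mem_biUnion.mpr ⟨⟨g, hg⟩, Finset.mem_univ _, Finset.mem_filter.mpr ⟨hc, hg'⟩⟩
    · refine (Finset.card_biUnion_le_card_mul _ _ (2 * ((h ^ k) ^ 2 / p + 1)) fun g _ => ?_).trans
        (by rw [Finset.card_univ, Nat.card_eq_fintype_card])
      refine card_coprime_le hp (g : (ZMod p)ˣ) (h ^ k) _ fun c hc => ?_
      obtain ⟨hc, hcg⟩ := Finset.mem_filter.mp hc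
      obtain ⟨t, ht, rfl⟩ := Finset.mem_image.mp hc
      obtain ⟨⟨h1, h2⟩, ⟨h3, h4⟩, h5, -⟩ := hφ t ht
      exact ⟨h1, h3, h2, h4, h5, hcg⟩

/-- Thinning loses `D²` before the `k`-th power, hence another `D^(2k)` beside the one from the
fibres. -/
theorem card_coprimeRatioPairs_pow_le {p : ℕ} [Fact p.Prime] (G : Subgroup (ZMod p)ˣ) {h k D : ℕ}
    (hk : k ≠ 0) (hD : ∀ n, 0 < n → n ≤ h ^ k → n.divisors.card ≤ D) :
    (coprimeRatioPairs G h).card ^ k ≤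
      D ^ (4 * k) * (Nat.card G * (2 * ((h ^ k) ^ 2 / p + 1))) := by
  have hmem := fun a (ha : a ∈ coprimeRatioPairs G h) =>
    mem_ratioPairs.mp (mem_coprimeRatioPairs.mp ha).1
  obtain ⟨A, hA, hcard, hcop⟩ := exists_subset_forall_coprime (coprimeRatioPairs G h) D
    (fun a ha => ⟨(hmem a ha).1.1.1.ne', (hmem a ha).1.2.1.ne'⟩)
    (fun a ha => (mem_coprimeRatioPairs.mp ha).2)
    (fun a ha => ⟨hD _ (hmem a ha).1.1.1 ((hmem a ha).1.1.2.trans (Nat.le_self_pow hk h)),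
      hD _ (hmem a ha).1.2.1 ((hmem a ha).1.2.2.trans (Nat.le_self_pow hk h))⟩)
  have key := card_pow_le_of_forall_coprime G hD A
    (hA.trans fun a ha => (mem_coprimeRatioPairs.mp ha).1) hcop
  calc (coprimeRatioPairs G h).card ^ k ≤ (D ^ 2 * A.card) ^ k := Nat.pow_le_pow_left hcard k
    _ = D ^ (2 * k) * A.card ^ k := by rw [mul_pow, ← pow_mul]
    _ ≤ _ := Nat.mul_le_mul_left _ key
    _ = _ := by rw [← mul_assoc, ← pow_add]; congr 2; ring

/-! ### Second moments of shifted character sums -/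

theorem norm_mulChar_le_one {p : ℕ} [Fact p.Prime] (χ : MulChar (ZMod p) ℂ) (x : ZMod p) :
    ‖χ x‖ ≤ 1 := DirichletCharacter.norm_le_one χ x

/-- The substitution `u = -(c - b)x - b` turns the correlation into `χ(-1)` times the Jacobi sum of
`χ` and `χ⁻¹`, which equals `-χ(-1)`. -/
theorem sum_mulChar_mul_star_shift {p : ℕ} [Fact p.Prime] {χ : MulChar (ZMod p) ℂ} (hχ : χ ≠ 1)
    {b c : ZMod p} (hbc : b ≠ c) : ∑ u, χ (u + b) * star (χ (u + c)) = -1 := by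
  have hd : c - b ≠ 0 := sub_ne_zero.mpr hbc.symm
  have hneg : χ (-1) * χ (-1) = 1 := by rw [← map_mul]; simp
  have hu : IsUnit (c - b) := hd.isUnit
  let e : ZMod p ≃ ZMod p :=
    (Equiv.mulLeft₀ (-(c - b)) (neg_ne_zero.mpr hd)).trans (Equiv.subRight b)
  rw [← e.sum_comp]
  have : ∀ x, χ (e x + b) * star (χ (e x + c)) = χ (-1) * (χ x * χ⁻¹ (1 - x)) := by
    intro x
    have e1 : e x + b = -1 * (c - b) * x := by simp [e]
    have e2 : e x + c = (c - b) * (1 - x) := by simp [e]; ring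
    have h1 : χ (c - b) * χ⁻¹ (c - b) = 1 := by
      rw [← MulChar.mul_apply, mul_inv_cancel, MulChar.one_apply hu]
    rw [MulChar.star_apply', e1, e2, map_mul, map_mul, map_mul]
    linear_combination χ (-1) * χ x * χ⁻¹ (1 - x) * h1
  rw [Finset.sum_congr rfl fun x _ => this x, ← Finset.mul_sum]
  have hj := jacobiSum_nontrivial_inv hχ
  rw [jacobiSum] at hj
  rw [hj, mul_neg, hneg]

theorem sum_norm_sq_sum_mulChar_le {p : ℕ} [Fact p.Prime] {χ : MulChar (ZMod p) ℂ} (hχ : χ ≠ 1)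
    {ι : Type*} [Fintype ι] (s : ι → ZMod p) (hs : Function.Injective s) :
    ∑ u, ‖∑ i, χ (u + s i)‖ ^ 2 ≤ 2 * p * Fintype.card ι := by
  classical
  have hcard : (Fintype.card ι : ℝ) ≤ p := by
    have := Fintype.card_le_of_injective s hs
    rw [ZMod.card] at this
    exact_mod_cast this
  have hexp : ((∑ u, ‖∑ i, χ (u + s i)‖ ^ 2 : ℝ) : ℂ) =
      ∑ i, ∑ j, ∑ u, χ (u + s i) * star (χ (u + s j)) := by
    push_cast
    rw [Finset.sum_congr rfl fun i _ => Finset.sum_comm, Finset.sum_comm]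
    refine Finset.sum_congr rfl fun u _ => ?_
    rw [← Complex.mul_conj', map_sum, Finset.sum_mul_sum]
    rfl
  have hterm : ∀ i j, ‖∑ u, χ (u + s i) * star (χ (u + s j))‖ ≤ (if i = j then (p : ℝ) else 0) + 1 := by
    intro i j
    split_ifs with h
    · refine (norm_sum_le _ _).trans ?_
      refine (Finset.sum_le_sum (g := fun _ => (1 : ℝ)) fun u _ => ?_).trans (by simp)
      rw [norm_mul, norm_star]
      exact mul_le_one₀ (norm_mulChar_le_one _ _) (norm_nonneg _) (norm_mulChar_le_one _ _)
    · rw [sum_mulChar_mul_star_shift hχ (hs.ne h)]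
      simp
  have hnn : 0 ≤ ∑ u, ‖∑ i, χ (u + s i)‖ ^ 2 := Finset.sum_nonneg fun _ _ => by positivity
  have h1 : ∑ u, ‖∑ i, χ (u + s i)‖ ^ 2 = ‖((∑ u, ‖∑ i, χ (u + s i)‖ ^ 2 : ℝ) : ℂ)‖ := by
    rw [Complex.norm_real, Real.norm_of_nonneg hnn]
  rw [h1, hexp]
  calc _ ≤ ∑ i, ∑ j, ((if i = j then (p : ℝ) else 0) + 1) :=
        (norm_sum_le _ _).trans (Finset.sum_le_sum fun i _ =>
          (norm_sum_le _ _).trans (Finset.sum_le_sum fun j _ => hterm i j))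
    _ = Fintype.card ι * (p + Fintype.card ι) := by
        simp [Finset.sum_add_distrib, mul_add]
    _ ≤ _ := by nlinarith [(Nat.cast_nonneg (Fintype.card ι) : (0 : ℝ) ≤ _)]

/-! ### Passing to pairs with ratio in the subgroup -/

theorem norm_sum_subgroup_mul {p : ℕ} [Fact p.Prime] (χ : MulChar (ZMod p) ℂ) (a : (ZMod p)ˣ)
    (G : Subgroup (ZMod p)ˣ) [Fintype G] (m : G) (x : ZMod p) :
    ‖∑ l : G, χ (((m : (ZMod p)ˣ) : ZMod p) * x + a * ((l : (ZMod p)ˣ) : ZMod p))‖ =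
      ‖∑ l : G, χ (x + a * ((l : (ZMod p)ˣ) : ZMod p))‖ := by
  have hm : ‖χ ((m : (ZMod p)ˣ) : ZMod p)‖ = 1 := DirichletCharacter.unit_norm_eq_one χ _
  rw [← Equiv.sum_comp (Equiv.mulLeft m)]
  have : ∀ l : G, χ (((m : (ZMod p)ˣ) : ZMod p) * x +
      a * ((((Equiv.mulLeft m) l : G) : (ZMod p)ˣ) : ZMod p)) =
      χ ((m : (ZMod p)ˣ) : ZMod p) * χ (x + a * ((l : (ZMod p)ˣ) : ZMod p)) := by
    intro l
    rw [← map_mul]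
    congr 1
    simp only [Equiv.coe_mulLeft, Subgroup.coe_mul, Units.val_mul]
    ring
  rw [Finset.sum_congr rfl fun l _ => this l, ← Finset.mul_sum, norm_mul, hm, one_mul]

theorem norm_intervalSubgroupSum_sq_le {p : ℕ} [Fact p.Prime] {χ : MulChar (ZMod p) ℂ}
    (hχ : χ ≠ 1) (a : (ZMod p)ˣ) {H : ℕ} (hH : H < p) (G : Subgroup (ZMod p)ˣ) :
    ‖intervalSubgroupSum χ a H G‖ ^ 2 ≤ 2 * p * (ratioPairs G H).card := by
  classical
  set F : ZMod p → ℝ := fun u => ‖∑ l : G, χ (u + a * ((l : (ZMod p)ˣ) : ZMod p))‖ with hF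
  set T : ℕ := Fintype.card G with hT
  have hT0 : 0 < (T : ℝ) := by exact_mod_cast Fintype.card_pos
  have hS : ‖intervalSubgroupSum χ a H G‖ ≤ ∑ x ∈ Finset.Icc 1 H, F x := by
    unfold intervalSubgroupSum
    convert norm_sum_le _ _ using 4
  set I := Finset.Icc 1 H ×ˢ (Finset.univ : Finset G) with hI
  let φ : ℕ × G → ZMod p := fun i => ((i.2 : (ZMod p)ˣ) : ZMod p) * i.1
  have hTS : (T : ℝ) * ∑ x ∈ Finset.Icc 1 H, F x = ∑ i ∈ I, F (φ i) := by
    rw [hI, Finset.sum_product, Finset.mul_sum]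
    refine Finset.sum_congr rfl fun x _ => ?_
    rw [Finset.sum_congr rfl fun m _ => norm_sum_subgroup_mul χ a G m x, Finset.sum_const,
      Finset.card_univ, nsmul_eq_mul]
  -- `N u` counts representations `u = m x` with `m` in `G` and `x ≤ H`.
  let N : ZMod p → ℝ := fun u => ((I.filter fun i => φ i = u).card : ℝ)
  have hN : ∀ f : ZMod p → ℝ, ∑ i ∈ I, f (φ i) = ∑ u, N u * f u := by
    intro f
    rw [← Finset.sum_fiberwise I φ]
    refine Finset.sum_congr rfl fun u _ => ?_
    rw [Finset.sum_congr rfl fun i hi => by rw [(Finset.mem_filter.mp hi).2], Finset.sum_const,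
      nsmul_eq_mul]
  have hcs : (∑ u, N u * F u) ^ 2 ≤ (∑ u, N u ^ 2) * ∑ u, F u ^ 2 :=
    Finset.sum_mul_sq_le_sq_mul_sq _ _ _
  have hF2 : ∑ u, F u ^ 2 ≤ 2 * p * T := by
    refine sum_norm_sq_sum_mulChar_le hχ (fun l : G => (a : ZMod p) * ((l : (ZMod p)ˣ) : ZMod p))
      fun l l' h => ?_
    exact Subtype.ext (Units.ext (mul_left_cancel₀ a.ne_zero h))
  have hN2 : ∑ u, N u ^ 2 ≤ T * (ratioPairs G H).card := by
    have e1 : ∑ u, N u ^ 2 = ∑ i ∈ I, N (φ i) := by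
      rw [hN]; exact Finset.sum_congr rfl fun u _ => sq _
    have e2 : ∑ i ∈ I, N (φ i) = (((I ×ˢ I).filter fun q => φ q.2 = φ q.1).card : ℝ) := by
      rw [Finset.card_filter, Finset.sum_product I I, Nat.cast_sum]
      exact Finset.sum_congr rfl fun i _ => by rw [← Finset.card_filter]
    rw [e1, e2]
    have : ((I ×ˢ I).filter fun q => φ q.2 = φ q.1).card ≤
        ((Finset.univ : Finset G) ×ˢ ratioPairs G H).card := by
      -- In `m x = m' y` the element `m'` is determined by `m, x, y`, since `0 < y < p`.
      refine Finset.card_le_card_of_injOn (fun q => (q.1.2, (q.1.1, q.2.1))) ?_ ?_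
      · intro q hq
        obtain ⟨hq, hφ⟩ := Finset.mem_filter.mp hq
        simp only [hI, Finset.mem_product, Finset.mem_Icc, Finset.mem_univ, and_true] at hq
        simp only [Finset.coe_product, Set.mem_prod, Finset.mem_coe, Finset.mem_univ, true_and]
        refine mem_ratioPairs.mpr ⟨hq, (q.1.2 : (ZMod p)ˣ)⁻¹ * q.2.2,
          G.mul_mem (G.inv_mem q.1.2.2) q.2.2.2, ?_⟩
        simp only [φ] at hφ
        rw [Units.val_mul, mul_assoc, hφ, Units.inv_mul_cancel_left]
      · intro q hq r hr h
        obtain ⟨hq, hφq⟩ := Finset.mem_filter.mp hq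
        obtain ⟨hr, hφr⟩ := Finset.mem_filter.mp hr
        simp only [hI, Finset.mem_product, Finset.mem_Icc, Finset.mem_univ, and_true] at hq
        obtain ⟨⟨q1, q2⟩, q3, q4⟩ := q
        obtain ⟨⟨r1, r2⟩, r3, r4⟩ := r
        simp only [Prod.mk.injEq, φ] at h hφq hφr hq ⊢
        obtain ⟨rfl, rfl, rfl⟩ := h
        have hne : (q3 : ZMod p) ≠ 0 := by
          rw [Ne, ZMod.natCast_eq_zero_iff]
          exact fun h => absurd (Nat.le_of_dvd (by omega) h) (by omega)
        refine ⟨⟨rfl, rfl⟩, rfl, Subtype.ext (Units.ext (mul_right_cancel₀ hne ?_))⟩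
        rw [hφq, hφr]
    rw [Finset.card_product, Finset.card_univ] at this
    exact_mod_cast this
  have hsum : (∑ x ∈ Finset.Icc 1 H, F x) ^ 2 ≤ 2 * p * (ratioPairs G H).card := by
    have h1 : ((T : ℝ) * ∑ x ∈ Finset.Icc 1 H, F x) ^ 2 ≤
        (T * (ratioPairs G H).card) * (2 * p * T) := by
      rw [hTS, hN]
      exact hcs.trans (mul_le_mul hN2 hF2 (Finset.sum_nonneg fun _ _ => by positivity)
        (by positivity))
    refine le_of_mul_le_mul_left ?_ (pow_pos hT0 2)
    linarith
  exact (pow_le_pow_left₀ (norm_nonneg _) hS 2).trans hsum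

/-! ### Estimates in powers of `p` -/

/-- `h1` and `h2` handle the terms `1` and `h^(2k)/p` respectively; `4kδ` pays for `D^(4k)`. -/
theorem card_coprimeRatioPairs_le_of_exponent {p : ℕ} [Fact p.Prime] (G : Subgroup (ZMod p)ˣ)
    {h k D : ℕ} {θ δ : ℝ} (hk : k ≠ 0) (hD : ∀ n, 0 < n → n ≤ h ^ k → n.divisors.card ≤ D)
    (hDp : (D : ℝ) ≤ (p : ℝ) ^ δ) (hT : (Nat.card G : ℝ) ≤ (p : ℝ) ^ (1 / 2 + δ))
    (hθ : (h : ℝ) = (p : ℝ) ^ θ) (h1 : 1 / 2 + δ + 4 * k * δ ≤ k * (θ + 1 / 24 + 7 * δ))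
    (h2 : 2 * k * θ - 1 + 1 / 2 + δ + 4 * k * δ ≤ k * (θ + 1 / 24 + 7 * δ)) :
    ((coprimeRatioPairs G h).card : ℝ) ≤ 4 * (h * (p : ℝ) ^ (1 / 24 + 7 * δ)) := by
  have hp1 : (1 : ℝ) ≤ p := by exact_mod_cast (Fact.out : p.Prime).one_lt.le
  have hp0 : (0 : ℝ) < p := by linarith
  have key : ((coprimeRatioPairs G h).card : ℝ) ^ k ≤
      (D : ℝ) ^ (4 * k) * (Nat.card G * (2 * (((h ^ k) ^ 2 / p : ℕ) + 1))) := by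
    exact_mod_cast card_coprimeRatioPairs_pow_le G hk hD
  have hdiv : (((h ^ k) ^ 2 / p : ℕ) : ℝ) ≤ (p : ℝ) ^ (2 * k * θ - 1) := by
    refine Nat.cast_div_le.trans (le_of_eq ?_)
    push_cast
    rw [hθ, Real.rpow_sub hp0, Real.rpow_one, ← pow_mul, ← Real.rpow_natCast,
      ← Real.rpow_mul hp0.le]
    congr 2
    push_cast; ring
  have hD4 : (D : ℝ) ^ (4 * k) ≤ (p : ℝ) ^ (4 * k * δ) := by
    refine (pow_le_pow_left₀ (Nat.cast_nonneg _) hDp _).trans (le_of_eq ?_)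
    rw [← Real.rpow_natCast, ← Real.rpow_mul hp0.le]
    congr 1
    push_cast; ring
  set R : ℝ := (p : ℝ) ^ (k * (θ + 1 / 24 + 7 * δ)) with hR
  have hR0 : 0 ≤ R := by positivity
  have hle : ((coprimeRatioPairs G h).card : ℝ) ^ k ≤ 4 * R := by
    refine key.trans ?_
    calc (D : ℝ) ^ (4 * k) * (Nat.card G * (2 * (((h ^ k) ^ 2 / p : ℕ) + 1)))
        ≤ (p : ℝ) ^ (4 * k * δ) * ((p : ℝ) ^ (1 / 2 + δ) * (2 * ((p : ℝ) ^ (2 * k * θ - 1) + 1))) := by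
          gcongr
      _ = 2 * ((p : ℝ) ^ (2 * k * θ - 1 + 1 / 2 + δ + 4 * k * δ) +
            (p : ℝ) ^ (1 / 2 + δ + 4 * k * δ)) := by
          rw [show 2 * k * θ - 1 + 1 / 2 + δ + 4 * k * δ =
            4 * k * δ + (1 / 2 + δ) + (2 * k * θ - 1) by ring,
            show 1 / 2 + δ + 4 * k * δ = 4 * k * δ + (1 / 2 + δ) by ring,
            Real.rpow_add hp0 (4 * k * δ + (1 / 2 + δ)), Real.rpow_add hp0 (4 * k * δ)]
          ring
      _ ≤ 2 * (R + R) := by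
          have := Real.rpow_le_rpow_of_exponent_le hp1 h1
          have := Real.rpow_le_rpow_of_exponent_le hp1 h2
          linarith
      _ = 4 * R := by ring
  refine le_of_pow_le_pow_left₀ hk (by positivity) (hle.trans ?_)
  rw [hθ, ← Real.rpow_add hp0, mul_pow, ← Real.rpow_natCast (_ ^ _), ← Real.rpow_mul hp0.le]
  have : R = (p : ℝ) ^ ((θ + (1 / 24 + 7 * δ)) * k) := by rw [hR]; congr 1; ring
  rw [← this]
  exact mul_le_mul_of_nonneg_right (le_self_pow₀ (by norm_num) hk) hR0

theorem card_coprimeRatioPairs_le {p : ℕ} [Fact p.Prime] (G : Subgroup (ZMod p)ˣ)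
    {h D : ℕ} {δ : ℝ} (hδ : 0 < δ) (hh : 0 < h) (hhp : h ≤ p)
    (hD : ∀ n, 0 < n → n ≤ p ^ 6 → n.divisors.card ≤ D) (hDp : (D : ℝ) ≤ (p : ℝ) ^ δ)
    (hT : (Nat.card G : ℝ) ≤ (p : ℝ) ^ (1 / 2 + δ)) (hH : (h : ℝ) ≤ (p : ℝ) ^ (1 / 4 + δ)) :
    ((coprimeRatioPairs G h).card : ℝ) ≤ 4 * (h * (p : ℝ) ^ (1 / 24 + 7 * δ)) := by
  have hp1 : (1 : ℝ) < p := by exact_mod_cast (Fact.out : p.Prime).one_lt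
  have hp0 : (0 : ℝ) < p := by linarith
  have hh0 : (0 : ℝ) < h := by exact_mod_cast hh
  set θ := Real.logb p h
  have hθ : (h : ℝ) = (p : ℝ) ^ θ := (Real.rpow_logb hp0 hp1.ne' hh0).symm
  have hθ0 : 0 ≤ θ := Real.logb_nonneg hp1 (by exact_mod_cast hh)
  have hθ1 : θ ≤ 1 / 4 + δ := by
    rw [hθ] at hH; exact (Real.rpow_le_rpow_left_iff hp1).mp hH
  have hD' : ∀ k ≤ 6, ∀ n, 0 < n → n ≤ h ^ k → n.divisors.card ≤ D := fun k hk n hn hnk =>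
    hD n hn (hnk.trans ((Nat.pow_le_pow_left hhp k).trans
      (Nat.pow_le_pow_right (Fact.out : p.Prime).pos hk)))
  -- Up to the `δ` terms, `k` is admissible for `1/(2k) - 1/24 ≤ θ ≤ 1/(2k) + 1/24`.
  rcases le_total θ (1 / 24) with c | c
  · calc ((coprimeRatioPairs G h).card : ℝ) ≤ (h : ℝ) ^ 2 := by
          exact_mod_cast card_coprimeRatioPairs_le_sq G h
      _ ≤ h * (p : ℝ) ^ (1 / 24 + 7 * δ) := by
          rw [sq]
          refine mul_le_mul_of_nonneg_left ?_ hh0.le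
          rw [hθ]
          exact Real.rpow_le_rpow_of_exponent_le hp1.le (by linarith)
      _ ≤ _ := by
          have : 0 ≤ h * (p : ℝ) ^ (1 / 24 + 7 * δ) := by positivity
          linarith
  rcases le_total θ (1 / 12) with c' | c'
  · refine card_coprimeRatioPairs_le_of_exponent (k := 6) G (by norm_num) (hD' 6 le_rfl) hDp hT hθ
      ?_ ?_ <;> push_cast <;> linarith
  rcases le_total θ (1 / 8) with c'' | c''
  · refine card_coprimeRatioPairs_le_of_exponent (k := 4) G (by norm_num) (hD' 4 (by norm_num))
      hDp hT hθ ?_ ?_ <;> push_cast <;> linarith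
  rcases le_total θ (5 / 24) with c3 | c3
  · refine card_coprimeRatioPairs_le_of_exponent (k := 3) G (by norm_num) (hD' 3 (by norm_num))
      hDp hT hθ ?_ ?_ <;> push_cast <;> linarith
  · refine card_coprimeRatioPairs_le_of_exponent (k := 2) G (by norm_num) (hD' 2 (by norm_num))
      hDp hT hθ ?_ ?_ <;> push_cast <;> linarith

/-- The coprime bound is linear in the height, so summing it over heights `H / d` costs only a
harmonic sum. -/
theorem card_ratioPairs_le {p : ℕ} [Fact p.Prime] (G : Subgroup (ZMod p)ˣ)
    {H D : ℕ} {δ : ℝ} (hδ : 0 < δ) (hHp : H < p)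
    (hD : ∀ n, 0 < n → n ≤ p ^ 6 → n.divisors.card ≤ D) (hDp : (D : ℝ) ≤ (p : ℝ) ^ δ)
    (hT : (Nat.card G : ℝ) ≤ (p : ℝ) ^ (1 / 2 + δ)) (hH : (H : ℝ) ≤ (p : ℝ) ^ (1 / 4 + δ)) :
    ((ratioPairs G H).card : ℝ) ≤
      4 * (1 + Real.log p) * (H * (p : ℝ) ^ (1 / 24 + 7 * δ)) := by
  rcases Nat.eq_zero_or_pos H with rfl | hH0
  · simp [ratioPairs]
  set R : ℝ := (p : ℝ) ^ (1 / 24 + 7 * δ)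
  have hR : 0 ≤ R := by positivity
  have hterm : ∀ d ∈ Finset.Icc 1 H,
      ((coprimeRatioPairs G (H / d)).card : ℝ) ≤ 4 * (H * R) * (d : ℝ)⁻¹ := by
    intro d hd
    obtain ⟨hd1, hd2⟩ := Finset.mem_Icc.mp hd
    have hle : H / d ≤ H := Nat.div_le_self _ _
    refine (card_coprimeRatioPairs_le G hδ (Nat.div_pos hd2 hd1) (by omega) hD hDp hT
      ((Nat.cast_le.mpr hle).trans hH)).trans ?_
    have : ((H / d : ℕ) : ℝ) ≤ H * (d : ℝ)⁻¹ := by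
      rw [← div_eq_mul_inv]; exact Nat.cast_div_le
    calc 4 * (((H / d : ℕ) : ℝ) * R) ≤ 4 * ((H * (d : ℝ)⁻¹) * R) := by gcongr
      _ = _ := by ring
  have hharm : ∑ d ∈ Finset.Icc 1 H, (d : ℝ)⁻¹ ≤ 1 + Real.log p := by
    have := harmonic_le_one_add_log H
    rw [harmonic_eq_sum_Icc] at this
    push_cast at this
    refine this.trans ?_
    have : Real.log H ≤ Real.log p :=
      Real.log_le_log (by exact_mod_cast hH0) (by exact_mod_cast hHp.le)
    linarith
  calc ((ratioPairs G H).card : ℝ)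
      ≤ ∑ d ∈ Finset.Icc 1 H, ((coprimeRatioPairs G (H / d)).card : ℝ) := by
        exact_mod_cast card_ratioPairs_le_sum G hHp
    _ ≤ ∑ d ∈ Finset.Icc 1 H, 4 * (H * R) * (d : ℝ)⁻¹ := Finset.sum_le_sum hterm
    _ = 4 * (H * R) * ∑ d ∈ Finset.Icc 1 H, (d : ℝ)⁻¹ := by rw [Finset.mul_sum]
    _ ≤ 4 * (H * R) * (1 + Real.log p) := by gcongr
    _ = _ := by ring

theorem norm_intervalSubgroupSum_le {p : ℕ} [Fact p.Prime] (G : Subgroup (ZMod p)ˣ)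
    {H D : ℕ} {δ : ℝ} (hδ : 0 < δ) (hδ1 : δ ≤ 1 / 2)
    (hD : ∀ n, 0 < n → n ≤ p ^ 6 → n.divisors.card ≤ D) (hDp : (D : ℝ) ≤ (p : ℝ) ^ δ)
    (hlog : 4 * (1 + Real.log p) ≤ (p : ℝ) ^ δ) (h2 : 2 ≤ (p : ℝ) ^ δ)
    (hT : (Nat.card G : ℝ) ≤ (p : ℝ) ^ (1 / 2 + δ)) (hT' : (p : ℝ) ^ (1 / 2 - δ) ≤ Nat.card G)
    (hH : (H : ℝ) ≤ (p : ℝ) ^ (1 / 4 + δ)) (hH' : (p : ℝ) ^ (1 / 4 - δ) ≤ H)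
    (a : (ZMod p)ˣ) {χ : MulChar (ZMod p) ℂ} (hχ : χ ≠ 1) :
    ‖intervalSubgroupSum χ a H G‖ ≤ H * Nat.card G * (p : ℝ) ^ (-5 / 48 + 6 * δ) := by
  have hp1 : (1 : ℝ) < p := by exact_mod_cast (Fact.out : p.Prime).one_lt
  have hp0 : (0 : ℝ) < p := by linarith
  have hHp : H < p := by
    have : (H : ℝ) < p := hH.trans_lt (by
      conv_rhs => rw [← Real.rpow_one (p : ℝ)]
      exact Real.rpow_lt_rpow_of_exponent_lt hp1 (by linarith))
    exact_mod_cast this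
  have hJ := card_ratioPairs_le G hδ hHp hD hDp hT hH
  refine le_of_pow_le_pow_left₀ two_ne_zero (by positivity) ?_
  calc ‖intervalSubgroupSum χ a H G‖ ^ 2 ≤ 2 * p * (ratioPairs G H).card :=
        norm_intervalSubgroupSum_sq_le hχ a hHp G
    _ ≤ (p : ℝ) ^ δ * (p : ℝ) ^ (1 : ℝ) * ((p : ℝ) ^ δ * (H * (p : ℝ) ^ (1 / 24 + 7 * δ))) := by
        rw [Real.rpow_one]
        refine mul_le_mul (by gcongr) (hJ.trans (by gcongr)) (by positivity) (by positivity)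
    -- Both sides carry `p^(25/24 + 9δ)` beside `H`; this balance determines the `6δ`.
    _ = H * ((p : ℝ) ^ (1 / 4 - δ) * ((p : ℝ) ^ (1 / 2 - δ)) ^ 2 *
          ((p : ℝ) ^ (-5 / 48 + 6 * δ)) ^ 2) := by
        simp only [← Real.rpow_natCast, ← Real.rpow_mul hp0.le, mul_left_comm _ (H : ℝ),
          ← Real.rpow_add hp0]
        congr 2
        push_cast; ring
    _ ≤ H * (H * (Nat.card G : ℝ) ^ 2 * ((p : ℝ) ^ (-5 / 48 + 6 * δ)) ^ 2) := by gcongr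
    _ = _ := by ring

/-! ### The trivial bound and the passage from every `ε` to `o(1)`. -/

theorem norm_intervalSubgroupSum_le_trivial {p : ℕ} [Fact p.Prime] (G : Subgroup (ZMod p)ˣ) (H : ℕ)
    (a : (ZMod p)ˣ) (χ : MulChar (ZMod p) ℂ) :
    ‖intervalSubgroupSum χ a H G‖ ≤ H * Nat.card G := by
  classical
  unfold intervalSubgroupSum
  refine (norm_sum_le_of_le _ (n := fun _ => (Nat.card G : ℝ)) fun x _ => ?_).trans (by simp)
  refine (norm_sum_le_of_le _ (n := fun _ => (1 : ℝ)) fun l _ => norm_mulChar_le_one χ _).trans ?_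
  simp [Nat.card_eq_fintype_card]

/-- The exponents admissible at `n` in a family of bounds can be chosen to tend to `0` as soon as
every positive exponent is eventually admissible. -/
theorem exists_tendsto_zero_of_forall_eventually {Q : ℕ → ℝ → Prop} {c : ℝ} (hc : 0 ≤ c)
    (hQc : ∀ n, Q n c) (hQ : ∀ ε > 0, ∀ᶠ n in atTop, Q n ε) :
    ∃ ρ : ℕ → ℝ, Tendsto ρ atTop (𝓝 0) ∧ ∀ n, Q n (ρ n) := by
  -- The infimum of admissible exponents need not be attained, so `ρ n` is taken within `1 / (n +
  -- 1)` of it.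
  have hex : ∀ n : ℕ, ∃ r, (0 ≤ r ∧ Q n r) ∧ r < sInf {r | 0 ≤ r ∧ Q n r} + 1 / ((n : ℝ) + 1) :=
    fun n => exists_lt_of_csInf_lt ⟨c, hc, hQc n⟩
      (lt_add_of_pos_right _ (by positivity))
  choose ρ hρ hlt using hex
  refine ⟨ρ, ?_, fun n => (hρ n).2⟩
  rw [Metric.tendsto_atTop']
  intro ε hε
  have h1 : ∀ᶠ n : ℕ in atTop, 1 / ((n : ℝ) + 1) < ε / 2 :=
    tendsto_one_div_add_atTop_nhds_zero_nat.eventually_lt_const (by linarith)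
  obtain ⟨N, hN⟩ := eventually_atTop.mp (h1.and (hQ (ε / 2) (by linarith)))
  refine ⟨N, fun n hn => ?_⟩
  obtain ⟨h2, h3⟩ := hN n hn.le
  have h4 : sInf {r | 0 ≤ r ∧ Q n r} ≤ ε / 2 :=
    csInf_le ⟨0, fun r hr => hr.1⟩ ⟨by linarith, h3⟩
  rw [Real.dist_eq, sub_zero, abs_of_nonneg (hρ n).1]
  linarith [hlt n]

theorem eventually_card_divisors_le {δ : ℝ} (hδ : 0 < δ) :
    ∀ᶠ p : ℕ in atTop, ∀ n, 0 < n → n ≤ p ^ 6 → n.divisors.card ≤ ⌊(p : ℝ) ^ δ⌋₊ := by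
  -- With `n ≤ p^6`, the exponent `δ / 12` gives `p^(δ/2)`; the other half absorbs `C`.
  obtain ⟨C, hC, hd⟩ := exists_card_divisors_le_rpow (ε := δ / 12) (by linarith)
  have h1 : ∀ᶠ p : ℕ in atTop, C ≤ (p : ℝ) ^ (δ / 2) :=
    ((tendsto_rpow_atTop (by linarith)).comp tendsto_natCast_atTop_atTop).eventually_ge_atTop C
  filter_upwards [h1, eventually_gt_atTop 0] with p hp hp0 n hn hnp
  have hp0' : (0 : ℝ) < p := by exact_mod_cast hp0
  refine Nat.le_floor ((hd n hn.ne').trans ?_)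
  have h2 : (n : ℝ) ^ (δ / 12) ≤ (p : ℝ) ^ (δ / 2) := by
    refine (Real.rpow_le_rpow (z := δ / 12) (Nat.cast_nonneg _)
      (by exact_mod_cast hnp : (n : ℝ) ≤ (p : ℝ) ^ 6) (by linarith)).trans (le_of_eq ?_)
    rw [← Real.rpow_natCast, ← Real.rpow_mul hp0'.le]
    congr 1
    push_cast; ring
  calc C * (n : ℝ) ^ (δ / 12) ≤ (p : ℝ) ^ (δ / 2) * (p : ℝ) ^ (δ / 2) := by gcongr
    _ = (p : ℝ) ^ δ := by rw [← Real.rpow_add hp0']; congr 1; ring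

theorem eventually_log_le_rpow {δ : ℝ} (hδ : 0 < δ) :
    ∀ᶠ p : ℕ in atTop, 4 * (1 + Real.log p) ≤ (p : ℝ) ^ δ := by
  have h1 := (isLittleO_log_rpow_atTop hδ).bound (show (0 : ℝ) < 1 / 8 by norm_num)
  have h2 := (tendsto_rpow_atTop hδ).eventually_ge_atTop 8
  filter_upwards [tendsto_natCast_atTop_atTop.eventually (h1.and h2)] with p hp
  have h3 := (le_abs_self _).trans hp.1
  rw [Real.norm_of_nonneg (by positivity)] at h3
  linarith [hp.2]

theorem theorem3 (α β : ℕ → ℝ) (hα : Tendsto α atTop (𝓝 0)) (hβ : Tendsto β atTop (𝓝 0)) :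
    ∃ ρ : ℕ → ℝ, Tendsto ρ atTop (𝓝 0) ∧
      ∀ (p : ℕ) [Fact p.Prime] (H T : ℕ),
        (p : ℝ) ^ ((1 : ℝ) / 4 - α p) ≤ (H : ℝ) → (H : ℝ) ≤ (p : ℝ) ^ ((1 : ℝ) / 4 + α p) →
        (p : ℝ) ^ ((1 : ℝ) / 2 - β p) ≤ (T : ℝ) → (T : ℝ) ≤ (p : ℝ) ^ ((1 : ℝ) / 2 + β p) →
        ∀ G : Subgroup (ZMod p)ˣ, Nat.card G = T →
        ∀ (a : (ZMod p)ˣ) (χ : MulChar (ZMod p) ℂ), χ ≠ 1 →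
          ‖intervalSubgroupSum χ a H G‖ ≤
            (H : ℝ) * (T : ℝ) * (p : ℝ) ^ (-(5 : ℝ) / 48 + ρ p) := by
  refine exists_tendsto_zero_of_forall_eventually
    (Q := fun p r => ∀ [Fact p.Prime] (H T : ℕ),
        (p : ℝ) ^ ((1 : ℝ) / 4 - α p) ≤ (H : ℝ) → (H : ℝ) ≤ (p : ℝ) ^ ((1 : ℝ) / 4 + α p) →
        (p : ℝ) ^ ((1 : ℝ) / 2 - β p) ≤ (T : ℝ) → (T : ℝ) ≤ (p : ℝ) ^ ((1 : ℝ) / 2 + β p) →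
        ∀ G : Subgroup (ZMod p)ˣ, Nat.card G = T →
        ∀ (a : (ZMod p)ˣ) (χ : MulChar (ZMod p) ℂ), χ ≠ 1 →
          ‖intervalSubgroupSum χ a H G‖ ≤
            (H : ℝ) * (T : ℝ) * (p : ℝ) ^ (-(5 : ℝ) / 48 + r))
    -- At `5/48` the power of `p` is `1`, and the claim is the trivial bound.
    (c := 5 / 48) (by norm_num) ?_ ?_
  · intro p _ H T _ _ _ _ G hG a χ _
    subst hG
    refine (norm_intervalSubgroupSum_le_trivial G H a χ).trans (le_of_eq ?_)
    norm_num
  · intro ε hε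
    set δ := min (ε / 6) (1 / 2) with hδdef
    have hδ : 0 < δ := lt_min (by linarith) (by norm_num)
    have hδε : 6 * δ ≤ ε := by linarith [min_le_left (ε / 6) (1 / 2)]
    filter_upwards [hα.eventually_lt_const hδ, hβ.eventually_lt_const hδ,
      eventually_card_divisors_le hδ, eventually_log_le_rpow hδ] with p hαp hβp hdiv hlog
    intro _ H T hH' hH hT' hT G hG a χ hχ
    subst hG
    have hp1 : (1 : ℝ) ≤ p := by exact_mod_cast (Fact.out : p.Prime).one_lt.le
    have hmono : ∀ {s t : ℝ}, s ≤ t → (p : ℝ) ^ s ≤ (p : ℝ) ^ t := fun h =>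
      Real.rpow_le_rpow_of_exponent_le hp1 h
    refine (norm_intervalSubgroupSum_le G hδ (min_le_right _ _) hdiv
      (Nat.floor_le (by positivity)) hlog (by linarith [Real.log_nonneg hp1])
      (hT.trans (hmono (by linarith))) ((hmono (by linarith)).trans hT')
      (hH.trans (hmono (by linarith))) ((hmono (by linarith)).trans hH') a hχ).trans ?_
    gcongr
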